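/- **Model.** Let $B$ be a finite set of buyers and let items $1,\dots,m$ arrive online in this order; $E\subseteq B\times\{1,\dots,m\}$ records which buyers are interested in which items, and buyer $i$ has value $v_i\ge 0$ for getting at least one item that she is interested in. When an item arrives, each buyer submits a bid $b_i\ge 0$ for it, where $b_i=0$ means that she declares no interest. A (deterministic) online algorithm decides immediately, from the bids on the items so far, to assign the item to some buyer who declares interest in it and has not received an item yet, or to leave it unassigned forever. A prompt mechanism also fixes at that moment a nonnegative price that the winner pays. Randomized algorithms and mechanisms are probability distributions over deterministic ones. The social welfare $\mathrm{SW}(\mu)$ of a matching $\mu$ is the sum of the values $v_i$ of the buyers who get an item that they are interested in; $\mathrm{OPT}$ is the welfare of a maximum weight matching of $E$. An algorithm is an $\alpha$ approximation if $\mathrm{OPT}\le\alpha\,\mathbb E[\mathrm{SW}(\mu)]$ for all $m$, $v$, $E$, where $\mu$ is its outcome when all buyers bid truthfully (buyer $i$ bids $v_i$ for $j$ if $(i,j)\in E$, and $0$ otherwise). **HonestPerturbedGreedy.** Before the first item arrives, draw $x_i$ independently and uniformly from $[0,1]$ for each buyer $i$, put $y_i=1-e^{x_i-1}$, and reveal all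 $x_i,y_i$ publicly. When an item arrives, let $N$ be the set of buyers without an item who declare interest in it. If $N=\emptyset$, the item is discarded. Otherwise assign it to some $i^\star\in\arg\max\{b_iy_i: i\in N\}$ at the price $\max\{\tfrac{y_i}{y_{i^\star}}b_i: i\in N\setminus\{i^\star\}\}$ (where $\max\emptyset=0$, and the price is $0$ if $y_{i^\star}=0$), and discard $i^\star$ from further consideration. Ties are broken by an arbitrary fixed rule that may depend on the bids for earlier items and on the set of tied buyers. **Theorem.** For every finite set of buyers and every such tie-breaking rule, the randomized prompt mechanism HonestPerturbedGreedy has the following properties. 1. It is truthful for myopic buyers in every realization of the $x_i$: in each round, after any history of bids and for any current bids of the other buyers, a buyer with value $v_i$ maximizes her utility of this round (her value for the item minus the price if she gets it, and $0$ otherwise) over all bids $z\ge0$ by bidding $v_i$ if she is interested in the item and $0$ if she is not. 2. It is ex-post individually rational: in every realization, the utility of a truthful bidder in a round is never negative. Moreover, every winner pays her critical price, the infimum of the bids with which she would have got the item given the bids of the others. 3. It is an $\frac{e}{e-1}$ approximation to the best offline matching, in expectation. The approximation is tight even for non-truthful randomized algorithms: for every $\alpha<\frac{e}{e-1}$ there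 are $n$ and $m$ such that for every randomized online algorithm for $n$ buyers and $m$ items, even one that is given all the values $v_i$ in advance, there is an instance with $n$ buyers and $m$ items on which $\alpha\,\mathbb E[\mathrm{SW}(\mu)]<\mathrm{OPT}$. -/

import Mathlib

universe u w

open scoped NNReal
open MeasureTheory

namespace OnlineMatching

/-! ### Online allocation of items to unit-demand buyers -/

/-- The bids received for one item. The value `0` means that the buyer declares that she is not
interested in the item. -/
abbrev Bids (B : Type*) := B → ℝ≥0

/-- The buyers who have received an item in the course of a history of bid vectors. Histories are
listed with the most recent item first. -/
def assignedBuyers {B : Type*} (alloc : List (Bids B) → Bids B → Option B) :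
    List (Bids B) → Set B
  | [] => ∅
  | b :: past => assignedBuyers alloc past ∪ {i | alloc past b = some i}

/-- A deterministic online algorithm for the buyers `B`. From the bids on the earlier items (most
recent first) and the bids on the current item it decides who gets the current item, if anybody.
An item may only go to a buyer who declares interest in it and has not received an item yet. -/
structure OnlineAlgorithm (B : Type*) where
  alloc : List (Bids B) → Bids B → Option B
  declared : ∀ past b i, alloc past b = some i → 0 < b i
  unassigned : ∀ past b i, alloc past b = some i → i ∉ assignedBuyers alloc past

/-- A deterministic prompt mechanism: an online algorithm that at once charges the buyer to whom
it assigns an item. (The price is not used if the item stays unassigned; a buyer who does not get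
the item pays nothing in that round.) -/
structure PromptMechanism (B : Type*) extends OnlineAlgorithm B where
  price : List (Bids B) → Bids B → ℝ≥0

/-- A randomized online algorithm: a random choice of a deterministic one. -/
structure RandomizedOnlineAlgorithm (B : Type u) : Type (max u (w + 1)) where
  Ω : Type w
  [measurableSpace : MeasurableSpace Ω]
  P : Measure Ω
  [isProbabilityMeasure : IsProbabilityMeasure P]
  realize : Ω → OnlineAlgorithm B
  measurableSet_alloc : ∀ past b i, MeasurableSet {ω | (realize ω).alloc past b = some i}

/-- A randomized prompt mechanism: a random choice of a deterministic one. -/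
structure RandomizedPromptMechanism (B : Type u) : Type (max u (w + 1)) where
  Ω : Type w
  [measurableSpace : MeasurableSpace Ω]
  P : Measure Ω
  [isProbabilityMeasure : IsProbabilityMeasure P]
  realize : Ω → PromptMechanism B
  measurableSet_alloc : ∀ past b i, MeasurableSet {ω | (realize ω).alloc past b = some i}
  measurable_price : ∀ past b, Measurable fun ω => (realize ω).price past b

attribute [instance] RandomizedOnlineAlgorithm.measurableSpace
  RandomizedOnlineAlgorithm.isProbabilityMeasure
  RandomizedPromptMechanism.measurableSpace
  RandomizedPromptMechanism.isProbabilityMeasure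

/-- The allocation part of a randomized prompt mechanism. -/
def RandomizedPromptMechanism.toRandomizedOnlineAlgorithm {B : Type u}
    (M : RandomizedPromptMechanism.{u, w} B) : RandomizedOnlineAlgorithm.{u, w} B where
  Ω := M.Ω
  P := M.P
  realize := fun ω => (M.realize ω).toOnlineAlgorithm
  measurableSet_alloc := M.measurableSet_alloc

/-! ### Welfare -/

section Welfare

variable {B : Type*} [DecidableEq B] {m : ℕ}

/-- The truthful bids in the graph with edge set `E`, where buyer `i` has value `v i`; item `j` is
the `j`-th item to arrive. -/
def truthfulBids (v : B → ℝ≥0) (E : Finset (B × Fin m)) (j : Fin m) : Bids B :=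
  fun i => if (i, j) ∈ E then v i else 0

/-- The assignment `j ↦ μ_j` that an online algorithm computes from a sequence of bid vectors. -/
def OnlineAlgorithm.outcome (A : OnlineAlgorithm B) (bids : Fin m → Bids B) (j : Fin m) :
    Option B :=
  A.alloc ((List.ofFn bids).take j).reverse (bids j)

open Classical in
/-- Social welfare: the total value of the buyers who get an item that they are interested in. -/
noncomputable def socialWelfare [Fintype B] (v : B → ℝ≥0) (E : Finset (B × Fin m))
    (μ : Fin m → Option B) : ℝ≥0 :=
  ∑ i, if ∃ j, μ j = some i ∧ (i, j) ∈ E then v i else 0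

/-- `μ` is a matching in the graph with edge set `E`. -/
def IsMatching (E : Finset (B × Fin m)) (μ : Fin m → Option B) : Prop :=
  (∀ j i, μ j = some i → (i, j) ∈ E) ∧
    ∀ j j' i, μ j = some i → μ j' = some i → j = j'

open Classical in
/-- The welfare of a maximum weight matching. -/
noncomputable def optWelfare [Fintype B] (v : B → ℝ≥0) (E : Finset (B × Fin m)) : ℝ≥0 :=
  (Finset.univ.filter (IsMatching E)).sup (socialWelfare v E)

/-- The expected social welfare of a randomized online algorithm when all bids are truthful. -/
noncomputable def RandomizedOnlineAlgorithm.expectedWelfare [Fintype B]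
    (A : RandomizedOnlineAlgorithm B) (v : B → ℝ≥0) (E : Finset (B × Fin m)) : ℝ :=
  ∫ ω, (socialWelfare v E ((A.realize ω).outcome (truthfulBids v E)) : ℝ) ∂A.P

/-- `A` is an `α` approximation to the best offline matching, in expectation. -/
def RandomizedOnlineAlgorithm.IsCompetitive [Fintype B] (A : RandomizedOnlineAlgorithm B)
    (α : ℝ) : Prop :=
  ∀ (m : ℕ) (v : B → ℝ≥0) (E : Finset (B × Fin m)),
    (optWelfare v E : ℝ) ≤ α * A.expectedWelfare v E

end Welfare

/-! ### Incentives of myopic buyers -/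

section Incentives

variable {B : Type*} [DecidableEq B]

/-- The utility in the current round of buyer `i`, whose value for the current item is `value`
(her value `v_i` if she is interested in the item, and `0` if not). -/
noncomputable def PromptMechanism.roundUtility (M : PromptMechanism B) (past : List (Bids B))
    (b : Bids B) (i : B) (value : ℝ≥0) : ℝ :=
  if M.alloc past b = some i then (value : ℝ) - M.price past b else 0

/-- Truthfulness for myopic buyers, for every realization of the mechanism: in each round, after
every history, and whatever the other buyers bid (`b`), buyer `i` with value `v` maximizes her
utility of the round by bidding `v` if she is interested in the item and by declaring no interest
otherwise. -/
def RandomizedPromptMechanism.IsTruthfulForMyopic (M : RandomizedPromptMechanism B) : Prop :=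
  ∀ (ω : M.Ω) (past : List (Bids B)) (b : Bids B) (i : B) (v : ℝ≥0) (interested : Bool) (z : ℝ≥0),
    (M.realize ω).roundUtility past (Function.update b i z) i (if interested then v else 0) ≤
      (M.realize ω).roundUtility past (Function.update b i (if interested then v else 0)) i
        (if interested then v else 0)

/-- Ex-post individual rationality: a buyer who bids truthfully never has negative utility. -/
def RandomizedPromptMechanism.IsIndividuallyRational (M : RandomizedPromptMechanism B) : Prop :=
  ∀ (ω : M.Ω) (past : List (Bids B)) (b : Bids B) (i : B) (v : ℝ≥0) (interested : Bool),
    0 ≤ (M.realize ω).roundUtility past (Function.update b i (if interested then v else 0)) i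
        (if interested then v else 0)

/-- In every realization, the buyer who gets an item pays her critical price: the infimum of the
bids with which she would have got it, given the bids of the others. -/
def RandomizedPromptMechanism.ChargesCriticalPrices (M : RandomizedPromptMechanism B) : Prop :=
  ∀ (ω : M.Ω) (past : List (Bids B)) (b : Bids B) (i : B),
    (M.realize ω).alloc past b = some i →
      (M.realize ω).price past b =
        sInf {z : ℝ≥0 | (M.realize ω).alloc past (Function.update b i z) = some i}

end Incentives

/-! ### The mechanism HonestPerturbedGreedy -/

/-- A rule that selects one buyer out of a nonempty set of tied buyers; the choice may depend on
the bids on the earlier items. -/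
abbrev TieBreakingRule (B : Type*) := List (Bids B) → (S : Finset B) → S.Nonempty → S

namespace HPG

/-- The multiplier `y = 1 - e ^ (x - 1)` for `x ∈ [0, 1]`. -/
noncomputable def multiplier (x : unitInterval) : ℝ≥0 :=
  ⟨1 - Real.exp ((x : ℝ) - 1), by
    have : Real.exp ((x : ℝ) - 1) ≤ 1 := Real.exp_le_one_iff.2 (by linarith [x.2.2])
    linarith⟩

variable {B : Type*}

/-- `N(j)`: the buyers, among the remaining ones `R`, who declare interest in the item. -/
noncomputable def interested (R : Finset B) (b : Bids B) : Finset B := R.filter fun i => 0 < b i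

/-- The set `argmax {b_i * y_i | i ∈ N}`. -/
noncomputable def topBidders (y : B → ℝ≥0) (N : Finset B) (b : Bids B) : Finset B :=
  N.filter fun i => ∀ k ∈ N, b k * y k ≤ b i * y i

theorem mem_interested {R : Finset B} {b : Bids B} {i : B} :
    i ∈ interested R b ↔ i ∈ R ∧ 0 < b i := by
  simp [interested]

theorem mem_topBidders {y : B → ℝ≥0} {N : Finset B} {b : Bids B} {i : B} :
    i ∈ topBidders y N b ↔ i ∈ N ∧ ∀ k ∈ N, b k * y k ≤ b i * y i := by
  simp [topBidders]

/-- The buyer who gets the item when `R` is the set of remaining buyers; nobody if `N(j) = ∅`. -/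
noncomputable def winner (tie : TieBreakingRule B) (y : B → ℝ≥0) (past : List (Bids B))
    (R : Finset B) (b : Bids B) : Option B :=
  if h : (topBidders y (interested R b) b).Nonempty then some (tie past _ h).1 else none

theorem winner_mem {tie : TieBreakingRule B} {y : B → ℝ≥0} {past : List (Bids B)}
    {R : Finset B} {b : Bids B} {i : B} (h : winner tie y past R b = some i) :
    i ∈ interested R b := by
  unfold winner at h
  split_ifs at h with hne
  have h1 := (tie past _ hne).2
  rw [Option.some.inj h] at h1
  exact (mem_topBidders.1 h1).1

theorem measurable_multiplier :
    Measurable fun (ω : B → unitInterval) (i : B) => multiplier (ω i) := by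
  refine measurable_pi_lambda _ fun i => ?_
  have h : Measurable multiplier := by
    refine Measurable.subtype_mk ?_
    fun_prop
  exact h.comp (measurable_pi_apply i)

theorem measurableSet_topBidders {Ω : Type*} [MeasurableSpace Ω] [Fintype B] {y : Ω → B → ℝ≥0}
    (hy : Measurable y) (N : Finset B) (b : Bids B) (S : Finset B) :
    MeasurableSet {ω | topBidders (y ω) N b = S} := by
  classical
  have key : ∀ i, MeasurableSet {ω | ∀ k ∈ N, b k * y ω k ≤ b i * y ω i} := by
    intro i
    simp only [Set.ofPred_forall]
    refine MeasurableSet.iInter fun k => MeasurableSet.iInter fun _ => ?_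
    exact measurableSet_le (((measurable_pi_apply k).comp hy).const_mul _)
      (((measurable_pi_apply i).comp hy).const_mul _)
  have hset : {ω | topBidders (y ω) N b = S} =
      ⋂ i, {ω | (i ∈ N ∧ ∀ k ∈ N, b k * y ω k ≤ b i * y ω i) ↔ i ∈ S} := by
    ext ω
    simp only [Set.mem_ofPred_eq, Set.mem_iInter, Finset.ext_iff, mem_topBidders]
  rw [hset]
  refine MeasurableSet.iInter fun i => ?_
  by_cases hN : i ∈ N <;> by_cases hS : i ∈ S <;> simp only [hN, hS, true_and, false_and, iff_true,
    iff_false]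
  · exact key i
  · exact (key i).compl
  · exact MeasurableSet.const _
  · exact MeasurableSet.const _

theorem measurableSet_winner {Ω : Type*} [MeasurableSpace Ω] [Fintype B] {y : Ω → B → ℝ≥0}
    (hy : Measurable y) (tie : TieBreakingRule B)
    (past : List (Bids B)) (R : Finset B) (b : Bids B) (o : Option B) :
    MeasurableSet {ω | winner tie (y ω) past R b = o} := by
  classical
  have hset : {ω | winner tie (y ω) past R b = o} =
      ⋃ S : Finset B, {ω | topBidders (y ω) (interested R b) b = S} ∩
        {_ω | (if h : S.Nonempty then some (tie past S h).1 else none) = o} := by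
    ext ω
    simp [winner]
  rw [hset]
  exact MeasurableSet.iUnion fun S =>
    (measurableSet_topBidders hy _ _ _).inter (MeasurableSet.const _)

variable [Fintype B] [DecidableEq B]

/-- The buyers who have not been discarded yet. -/
noncomputable def remaining (tie : TieBreakingRule B) (y : B → ℝ≥0) :
    List (Bids B) → Finset B
  | [] => Finset.univ
  | b :: past =>
      (remaining tie y past).filter fun i => winner tie y past (remaining tie y past) b ≠ some i

/-- The allocation rule. -/
noncomputable def alloc (tie : TieBreakingRule B) (y : B → ℝ≥0) (past : List (Bids B))
    (b : Bids B) : Option B :=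
  winner tie y past (remaining tie y past) b

/-- The payment rule `max {(y_k / y_i) * b_k | k ∈ N(j) \ {i}}`, where `i` is the winner; the
maximum over the empty set is `0`. (If `y_i = 0`, all products `y_k * b_k` with `k ∈ N(j)` are `0`,
and with the convention `0 / 0 = 0` the price is `0`.) -/
noncomputable def price (tie : TieBreakingRule B) (y : B → ℝ≥0) (past : List (Bids B))
    (b : Bids B) : ℝ≥0 :=
  match alloc tie y past b with
  | none => 0
  | some i => ((interested (remaining tie y past) b).erase i).sup fun k => y k / y i * b k

theorem mem_remaining {tie : TieBreakingRule B} {y : B → ℝ≥0} {past : List (Bids B)} {i : B}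
    (h : i ∈ remaining tie y past) : i ∉ assignedBuyers (alloc tie y) past := by
  induction past with
  | nil => simp [assignedBuyers]
  | cons b past ih =>
    rw [remaining, Finset.mem_filter] at h
    rw [assignedBuyers]
    rintro (h1 | h1)
    · exact ih h.1 h1
    · exact h.2 h1

/-- The mechanism for fixed multipliers `y`. -/
noncomputable def fixed (tie : TieBreakingRule B) (y : B → ℝ≥0) : PromptMechanism B where
  alloc := alloc tie y
  declared := fun _ _ _ h => (mem_interested.1 (winner_mem h)).2
  unassigned := fun _ _ _ h => mem_remaining (mem_interested.1 (winner_mem h)).1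
  price := price tie y

section Measurability

variable {Ω : Type*} [MeasurableSpace Ω] {y : Ω → B → ℝ≥0}

theorem measurableSet_remaining (hy : Measurable y) (tie : TieBreakingRule B)
    (past : List (Bids B)) (R : Finset B) :
    MeasurableSet {ω | remaining tie (y ω) past = R} := by
  induction past generalizing R with
  | nil => exact MeasurableSet.const (Finset.univ = R)
  | cons b past ih =>
    have hset : {ω | remaining tie (y ω) (b :: past) = R} =
        ⋃ Q : Finset B, ⋃ o : Option B, {ω | remaining tie (y ω) past = Q} ∩
          ({ω | winner tie (y ω) past Q b = o} ∩
            {_ω | (Q.filter fun i => o ≠ some i) = R}) := by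
      ext ω
      simp [remaining]
    rw [hset]
    exact MeasurableSet.iUnion fun Q => MeasurableSet.iUnion fun o =>
      (ih Q).inter ((measurableSet_winner hy _ _ _ _ _).inter (MeasurableSet.const _))

theorem measurableSet_alloc (hy : Measurable y) (tie : TieBreakingRule B)
    (past : List (Bids B)) (b : Bids B) (o : Option B) :
    MeasurableSet {ω | alloc tie (y ω) past b = o} := by
  have hset : {ω | alloc tie (y ω) past b = o} =
      ⋃ Q : Finset B, {ω | remaining tie (y ω) past = Q} ∩
        {ω | winner tie (y ω) past Q b = o} := by
    ext ω
    simp [alloc]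
  rw [hset]
  exact MeasurableSet.iUnion fun Q =>
    (measurableSet_remaining hy _ _ _).inter (measurableSet_winner hy _ _ _ _ _)

theorem measurable_price (hy : Measurable y) (tie : TieBreakingRule B)
    (past : List (Bids B)) (b : Bids B) :
    Measurable fun ω => price tie (y ω) past b := by
  classical
  have hsup : ∀ (T : Finset B) (i : B), Measurable fun ω => T.sup fun k => y ω k / y ω i * b k := by
    intro T i
    induction T using Finset.induction_on with
    | empty => simp
    | insert k T _ ih =>
      simp only [Finset.sup_insert]
      exact ((((measurable_pi_apply k).comp hy).div ((measurable_pi_apply i).comp hy)).mul_const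
        _).sup ih
  have hset : (fun ω => price tie (y ω) past b) = fun ω => ∑ Q : Finset B, ∑ i : B,
      if remaining tie (y ω) past = Q ∧ alloc tie (y ω) past b = some i then
        ((interested Q b).erase i).sup fun k => y ω k / y ω i * b k else 0 := by
    funext ω
    rw [Finset.sum_eq_single (remaining tie (y ω) past)]
    · unfold price
      cases h : alloc tie (y ω) past b <;> simp
    · intro Q _ hQ
      simp [hQ.symm]
    · simp
  rw [hset]
  refine Finset.measurable_sum _ fun Q _ => Finset.measurable_sum _ fun i _ => ?_
  exact Measurable.ite ((measurableSet_remaining hy _ _ _).inter (measurableSet_alloc hy _ _ _ _))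
    (hsup _ _) measurable_const

end Measurability

end HPG

/-- HonestPerturbedGreedy with tie-breaking rule `tie`: a point `x_i ∈ [0, 1]` is drawn uniformly
and independently for each buyer `i`, and the mechanism is run with `y_i = 1 - e ^ (x_i - 1)`. -/
noncomputable def honestPerturbedGreedy {B : Type*} [Fintype B] [DecidableEq B]
    (tie : TieBreakingRule B) : RandomizedPromptMechanism B where
  Ω := B → unitInterval
  P := Measure.pi fun _ => volume
  realize := fun x => HPG.fixed tie fun i => HPG.multiplier (x i)
  measurableSet_alloc := fun past b i =>
    HPG.measurableSet_alloc HPG.measurable_multiplier tie past b (some i)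
  measurable_price := fun past b => HPG.measurable_price HPG.measurable_multiplier tie past b

end OnlineMatching

/-! Incentives. The price `criticalPrice` that a buyer faces does not depend on her own bid. A
winning bid is at least this price, and a buyer who wins with some bid also wins with every bid
above it. The rest is the argument for second-price auctions.

Competitive ratio. Split the value v_i of a matched buyer into v_i (1 - y_i) = v_i e^(x_i - 1) for
herself and v_i y_i for her item. It suffices that for each edge (i, j) the expected shares of i and
j add up to at least (1 - 1/e) v_i (`mul_le_integral_shares`): summing over an optimal matching uses
each share at most once, and all shares together make up the welfare. To prove this for an edge, fix
all x_k with k ≠ i and let c be the highest perturbed bid for j in the run without i. The presence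
of i only enlarges the set of other buyers who are still available, so the share of j is at least c.
If v_i y_i > c, then i gets j or has already got another item. Writing c = v_i (1 - e^(s - 1)) with
s in [0, 1], the mean share of i is at least the integral of v_i e^(t - 1) over [0, s], which is v_i
(e^(s - 1) - e^(-1)); adding c gives (1 - 1/e) v_i. If c is too large for such an s, it suffices
alone. The comparison of the two runs needs unique maximizers, and ties have probability 0
(`ae_noTies`).

Lower bound. All values are 1 and the graph is upper triangular with randomly permuted buyers. The n
- j buyers interested in item j (counted from 0) are indistinguishable at that time, so the buyer at
position k ≥ j gets it with probability at most 1/(n - j). She is ever matched with probability at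
most min(1, Σ_{j ≤ k} 1/(n - j)), and these bounds sum to at most (1 - 1/e) n + 2, whereas the
optimum is n. Averaging yields one bad permutation for each randomized algorithm. -/

namespace OnlineMatching

/-! ### Incentives -/

namespace HPG

section Winner

variable {B : Type*} {tie : TieBreakingRule B} {y : B → ℝ≥0} {past : List (Bids B)}
  {R : Finset B} {b : Bids B} {i : B}

theorem winner_mem_topBidders (h : winner tie y past R b = some i) :
    i ∈ topBidders y (interested R b) b := by
  unfold winner at h
  split_ifs at h with hne
  have h1 := (tie past _ hne).2
  rwa [Option.some.inj h] at h1

theorem le_of_winner_eq_some (h : winner tie y past R b = some i) {k : B}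
    (hk : k ∈ interested R b) : b k * y k ≤ b i * y i :=
  (mem_topBidders.1 (winner_mem_topBidders h)).2 k hk

theorem winner_eq_some_of_lt (hi : i ∈ interested R b)
    (h : ∀ k ∈ interested R b, k ≠ i → b k * y k < b i * y i) :
    winner tie y past R b = some i := by
  have hmem : i ∈ topBidders y (interested R b) b := by
    refine mem_topBidders.2 ⟨hi, fun k hk => ?_⟩
    rcases eq_or_ne k i with rfl | hne
    · exact le_rfl
    · exact (h k hk hne).le
  have hne : (topBidders y (interested R b) b).Nonempty := ⟨i, hmem⟩
  rw [winner, dif_pos hne, Option.some_inj]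
  by_contra hw
  have hm := mem_topBidders.1 (tie past _ hne).2
  exact (h _ hm.1 hw).not_ge (hm.2 i hi)

theorem interested_eq_empty_of_winner_eq_none (h : winner tie y past R b = none) :
    interested R b = ∅ := by
  by_contra hne
  obtain ⟨i, hi, hmax⟩ := Finset.exists_max_image _ (fun k => b k * y k)
    (Finset.nonempty_iff_ne_empty.2 hne)
  rw [winner, dif_pos ⟨i, mem_topBidders.2 ⟨hi, hmax⟩⟩] at h
  simp at h

theorem winner_congr {y' : B → ℝ≥0} {R' : Finset B} {b' : Bids B}
    (h : topBidders y (interested R b) b = topBidders y' (interested R' b') b') :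
    winner tie y past R b = winner tie y' past R' b' := by
  unfold winner
  congr!

theorem mem_interested_update_of_ne [DecidableEq B] {z : ℝ≥0} {k : B} (hk : k ≠ i) :
    k ∈ interested R (Function.update b i z) ↔ k ∈ interested R b := by
  simp [mem_interested, hk]

end Winner

variable {B : Type*} [Fintype B] [DecidableEq B] {tie : TieBreakingRule B} {y : B → ℝ≥0}
  {past : List (Bids B)} {b : Bids B} {i : B}

/-- The price at which buyer `i` can get the current item. It does not depend on her own bid. -/
noncomputable def criticalPrice (tie : TieBreakingRule B) (y : B → ℝ≥0) (past : List (Bids B))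
    (b : Bids B) (i : B) : ℝ≥0 :=
  ((interested (remaining tie y past) b).erase i).sup fun k => y k / y i * b k

theorem criticalPrice_update (z : ℝ≥0) :
    criticalPrice tie y past (Function.update b i z) i = criticalPrice tie y past b i := by
  unfold criticalPrice
  refine Finset.sup_congr ?_ ?_
  · ext k
    simp only [Finset.mem_erase]
    exact and_congr_right fun hk => mem_interested_update_of_ne hk
  · intro k hk
    rw [Function.update_of_ne (Finset.ne_of_mem_erase hk)]

theorem price_eq_criticalPrice (h : alloc tie y past b = some i) :
    price tie y past b = criticalPrice tie y past b i := by
  rw [price, h]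
  rfl

theorem criticalPrice_le (h : alloc tie y past b = some i) :
    criticalPrice tie y past b i ≤ b i := by
  refine Finset.sup_le fun k hk => ?_
  rcases eq_or_ne (y i) 0 with hy | hy
  · simp [hy]
  · have h1 := le_of_winner_eq_some h (Finset.mem_of_mem_erase hk)
    rw [div_mul_eq_mul_div, div_le_iff₀ (pos_iff_ne_zero.2 hy), mul_comm]
    exact h1

/-- If `y i ≠ 0`, the new perturbed bid strictly beats all others, so ties play no role. If `y i =
0`, all perturbed bids in the round are 0 and the tie-breaking rule chose `i`; a different positive
bid leaves the tied set, and hence the choice, unchanged. -/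
theorem alloc_update_of_criticalPrice_lt (h : alloc tie y past b = some i) {z : ℝ≥0}
    (hz : criticalPrice tie y past b i < z) :
    alloc tie y past (Function.update b i z) = some i := by
  set R := remaining tie y past
  have hi := mem_interested.1 (winner_mem h)
  have hi' : i ∈ interested R (Function.update b i z) :=
    mem_interested.2 ⟨hi.1, by simpa using pos_of_gt hz⟩
  rcases eq_or_ne (y i) 0 with hy | hy
  · have hint : interested R (Function.update b i z) = interested R b := by
      ext k
      rcases eq_or_ne k i with rfl | hk
      · exact iff_of_true hi' (winner_mem h)
      · exact mem_interested_update_of_ne hk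
    have htop : topBidders y (interested R (Function.update b i z)) (Function.update b i z) =
        topBidders y (interested R b) b := by
      have hmul : ∀ k, Function.update b i z k * y k = b k * y k := by
        intro k
        rcases eq_or_ne k i with rfl | hk
        · simp [hy]
        · simp [hk]
      ext k
      simp only [mem_topBidders, hint, hmul]
    exact (winner_congr htop).trans h
  · refine winner_eq_some_of_lt hi' fun k hk hki => ?_
    have hk' : k ∈ (interested R b).erase i :=
      Finset.mem_erase.2 ⟨hki, (mem_interested_update_of_ne hki).1 hk⟩
    have h1 : y k / y i * b k < z :=
      (Finset.le_sup (f := fun k => y k / y i * b k) hk').trans_lt hz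
    rw [div_mul_eq_mul_div, div_lt_iff₀ (pos_iff_ne_zero.2 hy), mul_comm] at h1
    simpa [hki] using h1

theorem roundUtility_fixed_of_alloc (h : alloc tie y past b = some i) (value : ℝ≥0) :
    (fixed tie y).roundUtility past b i value = value - criticalPrice tie y past b i := by
  rw [PromptMechanism.roundUtility, ← price_eq_criticalPrice h]
  exact if_pos h

theorem roundUtility_fixed_of_alloc_ne (h : alloc tie y past b ≠ some i) (value : ℝ≥0) :
    (fixed tie y).roundUtility past b i value = 0 :=
  if_neg h

theorem roundUtility_fixed_nonneg (b : Bids B) (value : ℝ≥0) :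
    0 ≤ (fixed tie y).roundUtility past (Function.update b i value) i value := by
  by_cases h : alloc tie y past (Function.update b i value) = some i
  · have h1 := criticalPrice_le h
    rw [Function.update_self] at h1
    rw [roundUtility_fixed_of_alloc h, sub_nonneg]
    exact_mod_cast h1
  · rw [roundUtility_fixed_of_alloc_ne h]

theorem roundUtility_fixed_le (b : Bids B) (value z : ℝ≥0) :
    (fixed tie y).roundUtility past (Function.update b i z) i value ≤
      (fixed tie y).roundUtility past (Function.update b i value) i value := by
  by_cases h : alloc tie y past (Function.update b i z) = some i
  -- Either the true value exceeds the critical price, and then it wins too, at the same price; or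
  -- winning with `z` brings no positive utility.
  · rcases lt_or_ge (criticalPrice tie y past (Function.update b i z) i) value with hlt | hge
    · have h1 := alloc_update_of_criticalPrice_lt h hlt
      rw [Function.update_idem] at h1
      rw [roundUtility_fixed_of_alloc h, roundUtility_fixed_of_alloc h1, criticalPrice_update,
        criticalPrice_update]
    · refine le_trans ?_ (roundUtility_fixed_nonneg b value)
      rw [roundUtility_fixed_of_alloc h, sub_nonpos]
      exact_mod_cast hge
  · rw [roundUtility_fixed_of_alloc_ne h]
    exact roundUtility_fixed_nonneg b value

/-- A bid equal to the critical price may lose, through a tie or because it is 0, so the infimum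
need not be attained and the upper bound goes through density. -/
theorem price_eq_sInf (h : alloc tie y past b = some i) :
    price tie y past b = sInf {z : ℝ≥0 | alloc tie y past (Function.update b i z) = some i} := by
  rw [price_eq_criticalPrice h]
  refine le_antisymm ?_ ?_
  · refine le_csInf ⟨b i, ?_⟩ fun z hz => ?_
    · simpa using h
    · simpa [criticalPrice_update] using criticalPrice_le hz
  · exact le_of_forall_gt_imp_ge_of_dense fun z hz =>
      csInf_le (OrderBot.bddBelow _) (alloc_update_of_criticalPrice_lt h hz)

end HPG

section

variable {B : Type*} [Fintype B] [DecidableEq B] (tie : TieBreakingRule B)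

theorem honestPerturbedGreedy_isTruthfulForMyopic :
    (honestPerturbedGreedy tie).IsTruthfulForMyopic :=
  fun _ _ b _ _ _ _ => HPG.roundUtility_fixed_le b _ _

theorem honestPerturbedGreedy_isIndividuallyRational :
    (honestPerturbedGreedy tie).IsIndividuallyRational :=
  fun _ _ b _ _ _ => HPG.roundUtility_fixed_nonneg b _

theorem honestPerturbedGreedy_chargesCriticalPrices :
    (honestPerturbedGreedy tie).ChargesCriticalPrices :=
  fun _ _ _ _ h => HPG.price_eq_sInf h

end

/-! ### Outcomes of online algorithms -/

section Outcome

variable {B : Type*} {m : ℕ}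

/-- The bids on the items that arrive before item `j`, most recent first. -/
def history (bids : Fin m → Bids B) (j : ℕ) : List (Bids B) :=
  ((List.ofFn bids).take j).reverse

theorem history_zero (bids : Fin m → Bids B) : history bids 0 = [] := by
  simp [history]

theorem history_succ (bids : Fin m → Bids B) (j : Fin m) :
    history bids (j + 1) = bids j :: history bids j := by
  simp [history, List.take_add_one]

theorem mem_history {bids : Fin m → Bids B} {j : ℕ} {b : Bids B} (h : b ∈ history bids j) :
    ∃ l, bids l = b := by
  simpa using List.mem_of_mem_take (List.mem_reverse.1 h)

theorem history_congr {bids bids' : Fin m → Bids B} {j : ℕ} (hj : j ≤ m)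
    (h : ∀ l : Fin m, (l : ℕ) < j → bids l = bids' l) : history bids j = history bids' j := by
  induction j with
  | zero => simp [history_zero]
  | succ j ih =>
    have h1 := history_succ bids ⟨j, hj⟩
    have h2 := history_succ bids' ⟨j, hj⟩
    simp only at h1 h2
    rw [h1, h2, h ⟨j, hj⟩ (Nat.lt_succ_self j),
      ih (Nat.le_of_succ_le hj) fun l hl => h l (hl.trans (Nat.lt_succ_self j))]

namespace OnlineAlgorithm

variable (A : OnlineAlgorithm B) (bids : Fin m → Bids B)

theorem outcome_eq (j : Fin m) : A.outcome bids j = A.alloc (history bids j) (bids j) := rfl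

variable {A bids}

/-- This is what being online means; the indistinguishability argument of the lower bound rests on
it. -/
theorem outcome_congr {bids' : Fin m → Bids B} {j : Fin m} (h : ∀ l ≤ j, bids l = bids' l) :
    A.outcome bids j = A.outcome bids' j := by
  rw [outcome_eq, outcome_eq, h j le_rfl, history_congr j.2.le fun l hl => h l (le_of_lt hl)]

theorem mem_assignedBuyers_history {j : ℕ} (hj : j ≤ m) {i : B} :
    i ∈ assignedBuyers A.alloc (history bids j) ↔
      ∃ l : Fin m, (l : ℕ) < j ∧ A.outcome bids l = some i := by
  induction j with
  | zero => simp [history_zero, assignedBuyers]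
  | succ j ih =>
    have h1 := history_succ bids ⟨j, hj⟩
    simp only at h1
    rw [h1, assignedBuyers, Set.mem_union, ih (Nat.le_of_succ_le hj)]
    constructor
    · rintro (⟨l, hl, h⟩ | h)
      · exact ⟨l, hl.trans (Nat.lt_succ_self j), h⟩
      · exact ⟨⟨j, hj⟩, Nat.lt_succ_self j, h⟩
    · rintro ⟨l, hl, h⟩
      rcases Nat.lt_succ_iff_lt_or_eq.1 hl with hlt | heq
      · exact Or.inl ⟨l, hlt, h⟩
      · obtain rfl : l = ⟨j, hj⟩ := Fin.ext heq
        exact Or.inr h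

theorem outcome_injective {j j' : Fin m} {i : B} (h : A.outcome bids j = some i)
    (h' : A.outcome bids j' = some i) : j = j' := by
  by_contra hne
  wlog hlt : j < j' generalizing j j'
  · exact this h' h (Ne.symm hne) (lt_of_le_of_ne (not_lt.1 hlt) (Ne.symm hne))
  exact A.unassigned _ _ _ h' ((mem_assignedBuyers_history j'.2.le).2 ⟨j, hlt, h⟩)

theorem isMatching_outcome [DecidableEq B] (v : B → ℝ≥0) (E : Finset (B × Fin m)) :
    IsMatching E (A.outcome (truthfulBids v E)) := by
  refine ⟨fun j i h => ?_, fun j j' i => outcome_injective⟩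
  by_contra hE
  simpa [truthfulBids, hE] using A.declared _ _ _ h

end OnlineAlgorithm

open Classical in
-- Passes between sums over items and sums over matched buyers; no buyer is counted twice, since
-- each gets at most one item.
theorem sum_elim_eq_sum_ite [Fintype B] {M : Type*} [AddCommMonoid M] {μ : Fin m → Option B}
    (h : ∀ j j' i, μ j = some i → μ j' = some i → j = j') (f : B → M) :
    ∑ j, (μ j).elim 0 f = ∑ i, if ∃ j, μ j = some i then f i else 0 := by
  have h1 : ∀ j, (μ j).elim 0 f = ∑ i, if μ j = some i then f i else 0 := by
    intro j
    cases hj : μ j <;> simp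
  simp only [h1]
  rw [Finset.sum_comm]
  refine Finset.sum_congr rfl fun i _ => ?_
  split_ifs with hi
  · obtain ⟨j, hj⟩ := hi
    rw [Finset.sum_eq_single j]
    · simp [hj]
    · intro j' _ hj'
      exact if_neg fun h' => hj' (h _ _ _ h' hj)
    · simp
  · exact Finset.sum_eq_zero fun j _ => if_neg fun h' => hi ⟨j, h'⟩

theorem socialWelfare_eq_sum [Fintype B] [DecidableEq B] {v : B → ℝ≥0} {E : Finset (B × Fin m)}
    {μ : Fin m → Option B} (h : IsMatching E μ) :
    socialWelfare v E μ = ∑ j, (μ j).elim 0 v := by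
  classical
  rw [sum_elim_eq_sum_ite h.2, socialWelfare]
  refine Finset.sum_congr rfl fun i _ => ?_
  congr 1
  exact propext ⟨fun ⟨j, hj, _⟩ => ⟨j, hj⟩, fun ⟨j, hj⟩ => ⟨j, hj, h.1 j i hj⟩⟩

theorem socialWelfare_le [Fintype B] [DecidableEq B] (v : B → ℝ≥0) (E : Finset (B × Fin m))
    (μ : Fin m → Option B) : socialWelfare v E μ ≤ ∑ i, v i :=
  Finset.sum_le_sum fun i _ => by split_ifs <;> simp

namespace RandomizedOnlineAlgorithm

variable (A : RandomizedOnlineAlgorithm B)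

theorem measurableSet_outcome (bids : Fin m → Bids B) (j : Fin m) (i : B) :
    MeasurableSet {ω | (A.realize ω).outcome bids j = some i} :=
  A.measurableSet_alloc _ _ _

theorem measurable_socialWelfare [Fintype B] [DecidableEq B] (v : B → ℝ≥0) (E : Finset (B × Fin m))
    (bids : Fin m → Bids B) :
    Measurable fun ω => socialWelfare v E ((A.realize ω).outcome bids) := by
  classical
  refine Finset.measurable_sum _ fun i _ => Measurable.ite ?_ measurable_const measurable_const
  simp only [Set.ofPred_exists]
  exact MeasurableSet.iUnion fun j => (A.measurableSet_outcome bids j i).inter (.const _)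

theorem integrable_socialWelfare [Fintype B] [DecidableEq B] (v : B → ℝ≥0) (E : Finset (B × Fin m))
    (bids : Fin m → Bids B) :
    Integrable (fun ω => (socialWelfare v E ((A.realize ω).outcome bids) : ℝ)) A.P := by
  refine Integrable.of_bound
    (A.measurable_socialWelfare v E bids).coe_nnreal_real.aestronglyMeasurable
    ((∑ i, v i : ℝ≥0) : ℝ) (.of_forall fun ω => ?_)
  rw [Real.norm_of_nonneg (NNReal.coe_nonneg _)]
  exact_mod_cast socialWelfare_le v E _

end RandomizedOnlineAlgorithm

end Outcome

/-! ### Runs of the greedy algorithm without ties -/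

namespace HPG

variable {B : Type*}

/-- The highest perturbed bid in `R`. -/
noncomputable def topScore (y : B → ℝ≥0) (R : Finset B) (b : Bids B) : ℝ≥0 :=
  (interested R b).sup fun k => b k * y k

theorem topScore_mono {y : B → ℝ≥0} {R S : Finset B} (h : R ⊆ S) (b : Bids B) :
    topScore y R b ≤ topScore y S b :=
  Finset.sup_mono fun _ hk => mem_interested.2
    ⟨h (mem_interested.1 hk).1, (mem_interested.1 hk).2⟩

theorem topScore_congr {y y' : B → ℝ≥0} {R : Finset B} (h : ∀ k ∈ R, y k = y' k) (b : Bids B) :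
    topScore y R b = topScore y' R b :=
  Finset.sup_congr rfl fun k hk => by rw [h k (mem_interested.1 hk).1]

theorem winner_congr_multiplier {tie : TieBreakingRule B} {y y' : B → ℝ≥0}
    {past : List (Bids B)} {R : Finset B} (h : ∀ k ∈ R, y k = y' k) (b : Bids B) :
    winner tie y past R b = winner tie y' past R b := by
  refine winner_congr ?_
  ext i
  simp only [mem_topBidders]
  refine and_congr_right fun hi => forall₂_congr fun k hk => ?_
  rw [h i (mem_interested.1 hi).1, h k (mem_interested.1 hk).1]

theorem topScore_eq_elim (tie : TieBreakingRule B) (y : B → ℝ≥0) (past : List (Bids B))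
    (R : Finset B) (b : Bids B) :
    topScore y R b = (winner tie y past R b).elim 0 fun i => b i * y i := by
  cases h : winner tie y past R b with
  | none => simp [topScore, interested_eq_empty_of_winner_eq_none h]
  | some i =>
    exact le_antisymm (Finset.sup_le fun k hk => le_of_winner_eq_some h hk)
      (Finset.le_sup (f := fun k => b k * y k) (winner_mem h))

/-- No two buyers who declare interest have the same perturbed bid. -/
def NoTies (y : B → ℝ≥0) (b : Bids B) : Prop :=
  ∀ i k, 0 < b i → 0 < b k → i ≠ k → b i * y i ≠ b k * y k

/-- A unique maximizer stays the unique maximizer on any subset that contains it. The tie-breaking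
rule has no influence, so the two histories may differ. -/
theorem winner_eq_of_subset {tie : TieBreakingRule B} {y : B → ℝ≥0} {past past' : List (Bids B)}
    {R S : Finset B} {b : Bids B} (hb : NoTies y b) (hRS : R ⊆ S) {i : B}
    (h : winner tie y past S b = some i) (hi : i ∈ R) : winner tie y past' R b = some i := by
  have hpos := (mem_interested.1 (winner_mem h)).2
  refine winner_eq_some_of_lt (mem_interested.2 ⟨hi, hpos⟩) fun k hk hki => ?_
  have hk' := mem_interested.1 hk
  exact lt_of_le_of_ne (le_of_winner_eq_some h (mem_interested.2 ⟨hRS hk'.1, hk'.2⟩))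
    (hb k i hk'.2 hpos hki)

variable [DecidableEq B] {tie : TieBreakingRule B} {y : B → ℝ≥0} {past : List (Bids B)}

/-- The buyers who have not been discarded yet if the mechanism starts with the buyers in `R`. -/
noncomputable def remainingFrom (tie : TieBreakingRule B) (y : B → ℝ≥0) (R : Finset B) :
    List (Bids B) → Finset B
  | [] => R
  | b :: past =>
      (remainingFrom tie y R past).filter fun i =>
        winner tie y past (remainingFrom tie y R past) b ≠ some i

theorem remaining_eq_remainingFrom [Fintype B] :
    remaining tie y past = remainingFrom tie y Finset.univ past := by
  induction past with
  | nil => rfl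
  | cons b past ih => rw [remaining, remainingFrom, ih]

theorem remainingFrom_subset (R : Finset B) (past : List (Bids B)) :
    remainingFrom tie y R past ⊆ R := by
  induction past with
  | nil => exact subset_rfl
  | cons b past ih => exact (Finset.filter_subset _ _).trans ih

theorem remainingFrom_congr {y' : B → ℝ≥0} {R : Finset B} (h : ∀ k ∈ R, y k = y' k)
    (past : List (Bids B)) : remainingFrom tie y R past = remainingFrom tie y' R past := by
  induction past with
  | nil => rfl
  | cons b past ih =>
    have hw := winner_congr_multiplier (tie := tie) (past := past)
      (fun k hk => h k (remainingFrom_subset (tie := tie) (y := y') R past hk)) b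
    rw [remainingFrom, remainingFrom, ih, hw]

/-- By induction on the history: a buyer present in both runs who wins in the larger one also wins
in the smaller one, so whoever survives the smaller run survives the larger one. -/
theorem remainingFrom_mono (hpast : ∀ b ∈ past, NoTies y b) {R S : Finset B} (hRS : R ⊆ S) :
    remainingFrom tie y R past ⊆ remainingFrom tie y S past := by
  induction past with
  | nil => exact hRS
  | cons b past ih =>
    have ih' := ih fun b hb => hpast b (List.mem_cons_of_mem _ hb)
    intro k hk
    rw [remainingFrom, Finset.mem_filter] at hk ⊢
    exact ⟨ih' hk.1, fun hw =>
      hk.2 (winner_eq_of_subset (hpast b List.mem_cons_self) ih' hw hk.1)⟩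

/-- As long as `i` has won nothing, every earlier winner is a unique maximizer other than `i`, and
deleting `i` does not affect her. -/
theorem erase_remainingFrom (hpast : ∀ b ∈ past, NoTies y b) {S : Finset B} {i : B}
    (hi : i ∈ remainingFrom tie y S past) :
    (remainingFrom tie y S past).erase i = remainingFrom tie y (S.erase i) past := by
  induction past with
  | nil => rfl
  | cons b past ih =>
    rw [remainingFrom, Finset.mem_filter] at hi
    have ih' := ih (fun b hb => hpast b (List.mem_cons_of_mem _ hb)) hi.1
    rw [remainingFrom, remainingFrom, ← ih']
    ext k
    simp only [Finset.mem_erase, Finset.mem_filter, and_assoc]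
    refine and_congr_right fun hki => and_congr_right fun hk => not_congr ?_
    constructor
    · exact fun hw => winner_eq_of_subset (hpast b List.mem_cons_self) (Finset.erase_subset _ _) hw
        (Finset.mem_erase.2 ⟨hki, hk⟩)
    · intro hw
      cases hw' : winner tie y past (remainingFrom tie y S past) b with
      | none =>
        have hmem := mem_interested.1 (winner_mem hw)
        have hk' : k ∈ interested (remainingFrom tie y S past) b := mem_interested.2 ⟨hk, hmem.2⟩
        rw [interested_eq_empty_of_winner_eq_none hw'] at hk'
        exact absurd hk' (Finset.notMem_empty k)
      | some l =>
        have hl := (mem_interested.1 (winner_mem hw')).1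
        have hli : l ≠ i := by
          rintro rfl
          exact hi.2 hw'
        have h2 := winner_eq_of_subset (past' := past) (hpast b List.mem_cons_self)
          (Finset.erase_subset i _) hw' (Finset.mem_erase.2 ⟨hli, hl⟩)
        rw [← h2, hw]

/-- Without ties, a buyer who is still present and whose perturbed bid exceeds every perturbed bid
in the run without her gets the item. -/
theorem winner_eq_some_of_topScore_erase_lt (hpast : ∀ b ∈ past, NoTies y b) {S : Finset B}
    {b : Bids B} {i : B} (hi : i ∈ remainingFrom tie y S past) (hbi : 0 < b i)
    (h : topScore y (remainingFrom tie y (S.erase i) past) b < b i * y i) :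
    winner tie y past (remainingFrom tie y S past) b = some i := by
  refine winner_eq_some_of_lt (mem_interested.2 ⟨hi, hbi⟩) fun k hk hki => ?_
  refine lt_of_le_of_lt (Finset.le_sup (f := fun k => b k * y k) ?_) h
  rw [← erase_remainingFrom hpast hi]
  have hk' := mem_interested.1 hk
  exact mem_interested.2 ⟨Finset.mem_erase.2 ⟨hki, hk'.1⟩, hk'.2⟩

theorem mem_remaining_iff [Fintype B] {i : B} :
    i ∈ remaining tie y past ↔ i ∉ assignedBuyers (alloc tie y) past := by
  refine ⟨mem_remaining, fun h => ?_⟩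
  induction past with
  | nil => exact Finset.mem_univ i
  | cons b past ih =>
    rw [assignedBuyers, Set.mem_union, not_or] at h
    exact Finset.mem_filter.2 ⟨ih h.1, h.2⟩

end HPG

/-! ### Resampling one coordinate -/

theorem measurePreserving_update {ι : Type*} [Fintype ι] [DecidableEq ι] {X : ι → Type*}
    [∀ i, MeasurableSpace (X i)] (μ : ∀ i, Measure (X i)) [∀ i, IsProbabilityMeasure (μ i)]
    (i : ι) :
    MeasurePreserving (fun p : (∀ k, X k) × X i => Function.update p.1 i p.2)
      ((Measure.pi μ).prod (μ i)) (Measure.pi μ) := by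
  have hmeas : Measurable fun p : (∀ k, X k) × X i => Function.update p.1 i p.2 := by
    refine measurable_pi_lambda _ fun k => ?_
    rcases eq_or_ne k i with rfl | hk
    · simpa using measurable_snd
    · simp only [Function.update_of_ne hk]
      exact (measurable_pi_apply k).comp measurable_fst
  refine ⟨hmeas, Eq.symm (Measure.pi_eq fun s hs => ?_)⟩
  rw [Measure.map_apply hmeas (MeasurableSet.univ_pi hs)]
  -- The old `i`-th coordinate is overwritten, so it is unconstrained in the preimage of a box.
  have hpre : (fun p : (∀ k, X k) × X i => Function.update p.1 i p.2) ⁻¹' Set.univ.pi s =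
      Set.univ.pi (Function.update s i Set.univ) ×ˢ s i := by
    ext p
    simp only [Set.mem_preimage, Set.mem_univ_pi, Set.mem_prod]
    constructor
    · intro h
      refine ⟨fun k => ?_, by simpa using h i⟩
      rcases eq_or_ne k i with rfl | hk
      · simp
      · simpa [hk] using h k
    · rintro ⟨h, hi⟩ k
      rcases eq_or_ne k i with rfl | hk
      · simpa using hi
      · simpa [hk] using h k
  rw [hpre, Measure.prod_prod, Measure.pi_pi, ← Finset.prod_erase_mul _ _ (Finset.mem_univ i),
    ← Finset.prod_erase_mul Finset.univ (fun k => μ k (s k)) (Finset.mem_univ i)]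
  simp only [Function.update_self, measure_univ, mul_one]
  congr 1
  exact Finset.prod_congr rfl fun k hk => by rw [Function.update_of_ne (Finset.ne_of_mem_erase hk)]

/-- Fubini for a freshly drawn `i`-th coordinate: it makes precise the averaging over `x i` with the
other coordinates fixed. -/
theorem integral_pi_eq_integral_integral_update {ι : Type*} [Fintype ι] [DecidableEq ι]
    {X : ι → Type*} [∀ i, MeasurableSpace (X i)] (μ : ∀ i, Measure (X i))
    [∀ i, IsProbabilityMeasure (μ i)] (i : ι) {f : (∀ k, X k) → ℝ}
    (hf : Integrable f (Measure.pi μ)) :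
    Integrable (fun x => ∫ t, f (Function.update x i t) ∂μ i) (Measure.pi μ) ∧
      ∫ x, f x ∂Measure.pi μ = ∫ x, ∫ t, f (Function.update x i t) ∂μ i ∂Measure.pi μ := by
  have hmp := measurePreserving_update μ i
  have hint := hmp.integrable_comp_of_integrable hf
  refine ⟨hint.integral_prod_left, ?_⟩
  conv_lhs => rw [← hmp.map_eq]
  rw [integral_map hmp.measurable.aemeasurable (by rw [hmp.map_eq]; exact hf.1)]
  exact integral_prod _ hint

/-! ### The one-variable integral inequality -/

theorem volume_unitInterval_integral (f : ℝ → ℝ) :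
    ∫ t : unitInterval, f t = ∫ t in Set.Icc (0 : ℝ) 1, f t :=
  integral_subtype measurableSet_Icc f

/-- The inequality behind the competitive ratio: a buyer of value `v` who is matched whenever her
perturbed value exceeds `c` keeps, together with `c`, at least the fraction `1 - 1 / e` of `v`. -/
theorem mul_one_sub_exp_neg_one_le_integral {v c : ℝ} (hv : 0 < v) (hc : 0 ≤ c) :
    v * (1 - Real.exp (-1)) ≤
      ∫ t : unitInterval, ((if c < v * (1 - Real.exp ((t : ℝ) - 1)) then
        v * Real.exp ((t : ℝ) - 1) else 0) + c) := by
  have hmeas : Measurable fun t : ℝ =>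
      if c < v * (1 - Real.exp (t - 1)) then v * Real.exp (t - 1) else 0 :=
    Measurable.ite (measurableSet_lt measurable_const (by fun_prop)) (by fun_prop)
      measurable_const
  have hint : Integrable (fun t : unitInterval =>
      if c < v * (1 - Real.exp ((t : ℝ) - 1)) then v * Real.exp ((t : ℝ) - 1) else 0) := by
    refine Integrable.of_bound (hmeas.comp measurable_subtype_coe).aestronglyMeasurable v
      (.of_forall fun t => ?_)
    have h1 : Real.exp ((t : ℝ) - 1) ≤ 1 := Real.exp_le_one_iff.2 (by linarith [t.2.2])
    split_ifs
    · rw [Real.norm_of_nonneg (by positivity)]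
      exact mul_le_of_le_one_right hv.le h1
    · simpa using hv.le
  rw [integral_add hint (integrable_const _), integral_const, probReal_univ, one_smul]
  rcases le_or_gt (v * (1 - Real.exp (-1))) c with hlarge | hsmall
  · refine hlarge.trans (le_add_of_nonneg_left (integral_nonneg fun t => ?_))
    dsimp only
    split_ifs <;> positivity
  · have hcv : Real.exp (-1) < 1 - c / v := by
      have : c / v < 1 - Real.exp (-1) := by rwa [div_lt_iff₀ hv, mul_comm]
      linarith
    -- The point `s` is where the perturbed value drops to `c`: the buyer is matched for all `t <
    -- s`.
    obtain ⟨s, hs0, hs1, hs⟩ : ∃ s : ℝ, 0 ≤ s ∧ s ≤ 1 ∧ c = v * (1 - Real.exp (s - 1)) := by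
      have hpos : 0 < 1 - c / v := (Real.exp_pos _).trans hcv
      refine ⟨1 + Real.log (1 - c / v), ?_, ?_, ?_⟩
      · have := (Real.lt_log_iff_exp_lt hpos).2 hcv
        linarith
      · have := Real.log_nonpos hpos.le (by linarith [div_nonneg hc hv.le])
        linarith
      · rw [add_sub_cancel_left, Real.exp_log hpos]
        field_simp
        ring
    have hiff : ∀ t : ℝ, c < v * (1 - Real.exp (t - 1)) ↔ t < s := by
      intro t
      rw [hs, mul_lt_mul_iff_right₀ hv, sub_lt_sub_iff_left, Real.exp_lt_exp, sub_lt_sub_iff_right]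
    have hind : (fun t : ℝ => if c < v * (1 - Real.exp (t - 1)) then
        v * Real.exp (t - 1) else 0) = (Set.Iio s).indicator fun t => v * Real.exp (t - 1) := by
      funext t
      simp only [hiff, Set.indicator, Set.mem_Iio]
    have hset : Set.Icc (0 : ℝ) 1 ∩ Set.Iio s = Set.Ico 0 s := by
      ext t
      simp only [Set.mem_inter_iff, Set.mem_Icc, Set.mem_Iio, Set.mem_Ico]
      constructor
      · exact fun h => ⟨h.1.1, h.2⟩
      · exact fun h => ⟨⟨h.1, h.2.le.trans hs1⟩, h.2⟩
    rw [volume_unitInterval_integral fun t => if c < v * (1 - Real.exp (t - 1)) then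
      v * Real.exp (t - 1) else 0, hind, setIntegral_indicator measurableSet_Iio, hset,
      integral_Ico_eq_integral_Ioo, ← integral_Ioc_eq_integral_Ioo,
      ← intervalIntegral.integral_of_le hs0, intervalIntegral.integral_const_mul,
      intervalIntegral.integral_comp_sub_right (fun t => Real.exp t), integral_exp, zero_sub]
    linarith

/-! ### Ties have probability zero -/

namespace HPG

theorem coe_multiplier (t : unitInterval) :
    (multiplier t : ℝ) = 1 - Real.exp ((t : ℝ) - 1) := rfl

theorem multiplier_le_one (t : unitInterval) : multiplier t ≤ 1 := by
  rw [← NNReal.coe_le_coe, coe_multiplier]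
  simpa using (Real.exp_pos _).le

theorem multiplier_injective : Function.Injective multiplier := by
  intro s t h
  have h' : (multiplier s : ℝ) = multiplier t := by rw [h]
  rw [coe_multiplier, coe_multiplier, sub_right_inj, Real.exp_eq_exp, sub_left_inj] at h'
  exact Subtype.ext h'

section

variable {B : Type*} [Fintype B] [DecidableEq B]

/-- For a pair of buyers, redraw the coordinate of one of them: as her value is positive and the
multiplier is injective, at most one point of the unit interval produces a tie. -/
theorem ae_noTies (v : B → ℝ≥0) :
    ∀ᵐ x : B → unitInterval ∂Measure.pi fun _ => volume,
      NoTies (fun i => multiplier (x i)) v := by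
  have hmult (i : B) : Measurable fun x : B → unitInterval => multiplier (x i) :=
    (measurable_pi_apply i).comp measurable_multiplier
  simp only [NoTies, ae_all_iff]
  intro i k hi _ hik
  have hmp := measurePreserving_update (fun _ : B => (volume : Measure unitInterval)) i
  have hset : MeasurableSet {x : B → unitInterval |
      v i * multiplier (x i) ≠ v k * multiplier (x k)} :=
    (measurableSet_eq_fun ((hmult i).const_mul _) ((hmult k).const_mul _)).compl
  rw [← hmp.map_eq, ae_map_iff hmp.measurable.aemeasurable hset]
  refine (Measure.ae_prod_iff_ae_ae (hmp.measurable hset)).2 (.of_forall fun x => ?_)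
  refine (Set.Subsingleton.measure_zero (fun s hs t ht => ?_) volume :
    volume {t : unitInterval | ¬ (v i * multiplier (Function.update x i t i) ≠
      v k * multiplier (Function.update x i t k))} = 0)
  simp only [Function.update_self, Function.update_of_ne hik.symm, ne_eq, not_not,
    Set.mem_ofPred_eq] at hs ht
  exact multiplier_injective (mul_left_cancel₀ hi.ne' (hs.trans ht.symm))

end

end HPG

/-! ### The competitive ratio -/

namespace HPG

theorem measurable_multiplier_apply {B : Type*} (i : B) :
    Measurable fun x : B → unitInterval => multiplier (x i) :=
  (measurable_pi_apply i).comp measurable_multiplier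

theorem integrable_coe_of_le {Ω : Type*} [MeasurableSpace Ω] {P : Measure Ω} [IsFiniteMeasure P]
    {f : Ω → ℝ≥0} (hf : Measurable f) {C : ℝ≥0} (h : ∀ x, f x ≤ C) :
    Integrable (fun x => (f x : ℝ)) P := by
  refine Integrable.of_bound hf.coe_nnreal_real.aestronglyMeasurable (C : ℝ)
    (.of_forall fun x => ?_)
  rw [Real.norm_of_nonneg (NNReal.coe_nonneg _)]
  exact_mod_cast h x

theorem NoTies.truthfulBids {B : Type*} [DecidableEq B] {m : ℕ} {v : B → ℝ≥0}
    {E : Finset (B × Fin m)} {y : B → ℝ≥0} (h : NoTies y v) (j : Fin m) :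
    NoTies y (truthfulBids v E j) := by
  intro i k hi hk hik
  unfold OnlineMatching.truthfulBids at hi hk ⊢
  split_ifs at hi hk ⊢ with h1 h2 <;> first | exact absurd hi (lt_irrefl _) | skip
  · exact h i k hi hk hik
  · exact absurd hk (lt_irrefl _)

theorem noTies_of_mem_history {B : Type*} [DecidableEq B] {m : ℕ} {v : B → ℝ≥0}
    {E : Finset (B × Fin m)} {y : B → ℝ≥0} (hx : NoTies y v) {j : ℕ} :
    ∀ b ∈ history (truthfulBids v E) j, NoTies y b := by
  intro b hb
  obtain ⟨l, rfl⟩ := mem_history hb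
  exact hx.truthfulBids l

/-! ### Splitting the welfare into buyer and item shares -/

section

variable {B : Type*} [Fintype B] [DecidableEq B] {m : ℕ}

/-- The outcome of the mechanism with truthful bids when the points `x` are drawn. -/
noncomputable def run (tie : TieBreakingRule B) (v : B → ℝ≥0) (E : Finset (B × Fin m))
    (x : B → unitInterval) : Fin m → Option B :=
  (fixed tie fun i => multiplier (x i)).toOnlineAlgorithm.outcome (truthfulBids v E)

open Classical in
/-- The part of the welfare that is credited to buyer `i`. -/
noncomputable def buyerShare (tie : TieBreakingRule B) (v : B → ℝ≥0) (E : Finset (B × Fin m))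
    (i : B) (x : B → unitInterval) : ℝ≥0 :=
  if ∃ j, run tie v E x j = some i then v i * (1 - multiplier (x i)) else 0

/-- The part of the welfare that is credited to item `j`. -/
noncomputable def itemShare (tie : TieBreakingRule B) (v : B → ℝ≥0) (E : Finset (B × Fin m))
    (j : Fin m) (x : B → unitInterval) : ℝ≥0 :=
  (run tie v E x j).elim 0 fun k => v k * multiplier (x k)

variable (tie : TieBreakingRule B) (v : B → ℝ≥0) (E : Finset (B × Fin m))

theorem isMatching_run (x : B → unitInterval) : IsMatching E (run tie v E x) :=
  OnlineAlgorithm.isMatching_outcome v E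

theorem sum_share (x : B → unitInterval) :
    ∑ i, buyerShare tie v E i x + ∑ j, itemShare tie v E j x =
      socialWelfare v E (run tie v E x) := by
  have h := isMatching_run tie v E x
  rw [socialWelfare_eq_sum h, sum_elim_eq_sum_ite h.2]
  unfold itemShare
  rw [sum_elim_eq_sum_ite h.2, ← Finset.sum_add_distrib]
  refine Finset.sum_congr rfl fun i _ => ?_
  unfold buyerShare
  split_ifs
  · rw [← mul_add, tsub_add_cancel_of_le (multiplier_le_one _), mul_one]
  · simp

theorem measurableSet_run (j : Fin m) (i : B) :
    MeasurableSet {x | run tie v E x j = some i} :=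
  measurableSet_alloc measurable_multiplier tie _ _ _

theorem measurable_buyerShare (i : B) : Measurable (buyerShare tie v E i) := by
  classical
  refine Measurable.ite ?_ ?_ measurable_const
  · simp only [Set.ofPred_exists]
    exact MeasurableSet.iUnion fun j => measurableSet_run tie v E j i
  · exact ((measurable_multiplier_apply i).const_sub 1).const_mul _

theorem measurable_itemShare (j : Fin m) : Measurable (itemShare tie v E j) := by
  have h : itemShare tie v E j = fun x => ∑ k, if run tie v E x j = some k then
      v k * multiplier (x k) else 0 := by
    funext x
    unfold itemShare
    cases h : run tie v E x j <;> simp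
  rw [h]
  exact Finset.measurable_sum _ fun k _ => Measurable.ite (measurableSet_run tie v E j k)
    ((measurable_multiplier_apply k).const_mul _) measurable_const

theorem buyerShare_le (i : B) (x : B → unitInterval) :
    buyerShare tie v E i x ≤ ∑ k, v k := by
  refine le_trans ?_ (socialWelfare_le v E (run tie v E x))
  rw [← sum_share]
  exact le_add_right (Finset.single_le_sum (f := fun i => buyerShare tie v E i x)
    (fun _ _ => zero_le) (Finset.mem_univ i))

theorem itemShare_le (j : Fin m) (x : B → unitInterval) :
    itemShare tie v E j x ≤ ∑ k, v k := by
  refine le_trans ?_ (socialWelfare_le v E (run tie v E x))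
  rw [← sum_share]
  exact le_add_left (Finset.single_le_sum (f := fun j => itemShare tie v E j x)
    (fun _ _ => zero_le) (Finset.mem_univ j))

variable {tie v E}

/-- The highest perturbed bid for item `j` in the run without buyer `i`. -/
noncomputable def threshold (tie : TieBreakingRule B) (v : B → ℝ≥0) (E : Finset (B × Fin m))
    (i : B) (j : Fin m) (x : B → unitInterval) : ℝ≥0 :=
  topScore (fun k => multiplier (x k)) (remainingFrom tie (fun k => multiplier (x k))
    (Finset.univ.erase i) (history (truthfulBids v E) j)) (truthfulBids v E j)

/-- The run without `i` never looks at `x i`, so the threshold is a constant in the integral over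
this coordinate. -/
theorem threshold_update (i : B) (j : Fin m) (x : B → unitInterval) (t : unitInterval) :
    threshold tie v E i j (Function.update x i t) = threshold tie v E i j x := by
  have h : ∀ k ∈ Finset.univ.erase i,
      multiplier (Function.update x i t k) = multiplier (x k) := fun k hk => by
    rw [Function.update_of_ne (Finset.ne_of_mem_erase hk)]
  unfold threshold
  rw [remainingFrom_congr h]
  exact topScore_congr (fun k hk => h k (remainingFrom_subset _ _ hk)) _

variable {x : B → unitInterval}

theorem itemShare_eq_topScore (j : Fin m) :
    itemShare tie v E j x = topScore (fun k => multiplier (x k))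
      (remaining tie (fun k => multiplier (x k)) (history (truthfulBids v E) j))
      (truthfulBids v E j) := by
  rw [topScore_eq_elim tie _ (history (truthfulBids v E) j)]
  change (run tie v E x j).elim 0 _ = (run tie v E x j).elim 0 _
  cases h : run tie v E x j with
  | none => rfl
  | some i => simp [truthfulBids, (isMatching_run tie v E x).1 j i h]

theorem threshold_le_itemShare (hx : NoTies (fun k => multiplier (x k)) v) (i : B) (j : Fin m) :
    threshold tie v E i j x ≤ itemShare tie v E j x := by
  rw [itemShare_eq_topScore, remaining_eq_remainingFrom]
  exact topScore_mono (remainingFrom_mono (noTies_of_mem_history hx) (Finset.erase_subset _ _)) _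

/-- If `i` is still present when `j` arrives, she beats all competitors for it; otherwise she has
been discarded because she got an earlier item. -/
theorem exists_run_eq_some (hx : NoTies (fun k => multiplier (x k)) v) {i : B} {j : Fin m}
    (hE : (i, j) ∈ E) (hi : 0 < v i) (h : threshold tie v E i j x < v i * multiplier (x i)) :
    ∃ l, run tie v E x l = some i := by
  have hbid : truthfulBids v E j i = v i := if_pos hE
  by_cases hmem : i ∈ remaining tie (fun k => multiplier (x k)) (history (truthfulBids v E) j)
  · refine ⟨j, ?_⟩
    rw [remaining_eq_remainingFrom] at hmem
    have h1 := winner_eq_some_of_topScore_erase_lt (noTies_of_mem_history hx) hmem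
      (b := truthfulBids v E j) (by rwa [hbid]) (by rw [hbid]; exact h)
    rw [← remaining_eq_remainingFrom] at h1
    exact h1
  · rw [mem_remaining_iff, not_not] at hmem
    obtain ⟨l, -, hl⟩ := (OnlineAlgorithm.mem_assignedBuyers_history
      (A := (fixed tie fun k => multiplier (x k)).toOnlineAlgorithm) j.2.le).1 hmem
    exact ⟨l, hl⟩

/-- The left side, as a function of `x i` alone, is the integrand of
`mul_one_sub_exp_neg_one_le_integral`. -/
theorem le_shares (hx : NoTies (fun k => multiplier (x k)) v) {i : B} {j : Fin m}
    (hE : (i, j) ∈ E) (hi : 0 < v i) :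
    (if (threshold tie v E i j x : ℝ) < v i * (1 - Real.exp ((x i : ℝ) - 1)) then
      v i * Real.exp ((x i : ℝ) - 1) else 0) + (threshold tie v E i j x : ℝ) ≤
    (buyerShare tie v E i x : ℝ) + itemShare tie v E j x := by
  refine add_le_add ?_ (NNReal.coe_le_coe.2 (threshold_le_itemShare hx i j))
  split_ifs with h
  · rw [← coe_multiplier, ← NNReal.coe_mul, NNReal.coe_lt_coe] at h
    rw [buyerShare, if_pos (exists_run_eq_some hx hE hi h), NNReal.coe_mul,
      NNReal.coe_sub (multiplier_le_one _), coe_multiplier]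
    simp
  · exact NNReal.coe_nonneg _

theorem integrable_buyerShare (i : B) :
    Integrable (fun x => (buyerShare tie v E i x : ℝ)) (Measure.pi fun _ => volume) :=
  integrable_coe_of_le (measurable_buyerShare tie v E i) (buyerShare_le tie v E i)

theorem integrable_itemShare (j : Fin m) :
    Integrable (fun x => (itemShare tie v E j x : ℝ)) (Measure.pi fun _ => volume) :=
  integrable_coe_of_le (measurable_itemShare tie v E j) (itemShare_le tie v E j)

/-- Each edge is covered in expectation by the shares of its endpoints. -/
theorem mul_le_integral_shares {i : B} {j : Fin m} (hE : (i, j) ∈ E) :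
    (v i : ℝ) * (1 - Real.exp (-1)) ≤
      (∫ x, (buyerShare tie v E i x : ℝ) ∂Measure.pi fun _ => volume) +
        ∫ x, (itemShare tie v E j x : ℝ) ∂Measure.pi fun _ => volume := by
  rcases (zero_le (a := v i)).eq_or_lt with hi | hi
  · rw [← hi, NNReal.coe_zero, zero_mul]
    exact add_nonneg (integral_nonneg fun _ => NNReal.coe_nonneg _)
      (integral_nonneg fun _ => NNReal.coe_nonneg _)
  rw [← integral_add (integrable_buyerShare i) (integrable_itemShare j)]
  obtain ⟨hint, heq⟩ := integral_pi_eq_integral_integral_update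
    (fun _ : B => (volume : Measure unitInterval)) i
    ((integrable_buyerShare (tie := tie) (v := v) (E := E) i).add (integrable_itemShare j))
  simp only [Pi.add_apply] at hint heq
  rw [heq]
  have hmp := measurePreserving_update (fun _ : B => (volume : Measure unitInterval)) i
  -- For almost every `x`, almost every new value of coordinate `i` leaves no ties.
  have hae := Measure.ae_ae_of_ae_prod (hmp.quasiMeasurePreserving.ae (ae_noTies v))
  calc (v i : ℝ) * (1 - Real.exp (-1))
      = ∫ _x : B → unitInterval, (v i : ℝ) * (1 - Real.exp (-1))
          ∂Measure.pi fun _ => volume := by simp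
    _ ≤ _ := by
      refine integral_mono_ae (integrable_const _) hint ?_
      filter_upwards [hae] with x hx
      refine (mul_one_sub_exp_neg_one_le_integral (c := threshold tie v E i j x)
        (NNReal.coe_pos.2 hi) (NNReal.coe_nonneg _)).trans ?_
      have hup : Measurable fun t : unitInterval => Function.update x i t :=
        hmp.measurable.comp measurable_prodMk_left
      refine integral_mono_of_nonneg (.of_forall fun t => ?_) ?_ ?_
      · dsimp only [Pi.zero_apply]
        split_ifs <;> positivity
      · exact (integrable_coe_of_le ((measurable_buyerShare tie v E i).comp hup)
          fun t => buyerShare_le tie v E i _).add (integrable_coe_of_le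
            ((measurable_itemShare tie v E j).comp hup) fun t => itemShare_le tie v E j _)
      · filter_upwards [hx] with t ht
        have h := le_shares ht (tie := tie) hE hi
        rw [threshold_update] at h
        simpa only [Function.update_self] using h

/-- Weak duality: the expected shares, divided by 1 - 1/e, form a fractional cover of the edges.
Shares of unmatched buyers and items are dropped because they are nonnegative. -/
theorem socialWelfare_mul_le {μ : Fin m → Option B} (hμ : IsMatching E μ) :
    (socialWelfare v E μ : ℝ) * (1 - Real.exp (-1)) ≤
      ∫ x, (socialWelfare v E (run tie v E x) : ℝ) ∂Measure.pi fun _ => volume := by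
  classical
  set β : B → ℝ := fun i => ∫ x, (buyerShare tie v E i x : ℝ) ∂Measure.pi fun _ => volume with hβ
  set γ : Fin m → ℝ := fun j => ∫ x, (itemShare tie v E j x : ℝ) ∂Measure.pi fun _ => volume
    with hγ
  have hβ0 : ∀ i, 0 ≤ β i := fun i => integral_nonneg fun _ => NNReal.coe_nonneg _
  have hγ0 : ∀ j, 0 ≤ γ j := fun j => integral_nonneg fun _ => NNReal.coe_nonneg _
  have htotal : ∫ x, (socialWelfare v E (run tie v E x) : ℝ) ∂Measure.pi (fun _ => volume) =
      ∑ i, β i + ∑ j, γ j := by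
    simp only [← sum_share, NNReal.coe_add, NNReal.coe_sum]
    rw [integral_add (integrable_finsetSum _ fun i _ => integrable_buyerShare i)
      (integrable_finsetSum _ fun j _ => integrable_itemShare j),
      integral_finsetSum _ fun i _ => integrable_buyerShare i,
      integral_finsetSum _ fun j _ => integrable_itemShare j]
  rw [htotal, socialWelfare_eq_sum hμ, NNReal.coe_sum, Finset.sum_mul]
  calc ∑ j, (((μ j).elim 0 v : ℝ≥0) : ℝ) * (1 - Real.exp (-1))
      ≤ ∑ j, ((μ j).elim 0 β + γ j) := by
        refine Finset.sum_le_sum fun j _ => ?_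
        cases hj : μ j with
        | none => simpa using hγ0 j
        | some i => exact mul_le_integral_shares (hμ.1 j i hj)
    _ = (∑ i, if ∃ j, μ j = some i then β i else 0) + ∑ j, γ j := by
        rw [Finset.sum_add_distrib, sum_elim_eq_sum_ite hμ.2]
        congr!
    _ ≤ ∑ i, β i + ∑ j, γ j := by
        gcongr with i
        split_ifs
        · exact le_rfl
        · exact hβ0 i

end

end HPG

theorem one_sub_exp_neg_one_pos : 0 < 1 - Real.exp (-1) :=
  sub_pos.2 (Real.exp_lt_one_iff.2 (by norm_num))

theorem exp_one_div_exp_one_sub_one :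
    Real.exp 1 / (Real.exp 1 - 1) = (1 - Real.exp (-1))⁻¹ := by
  rw [Real.exp_neg, ← inv_div, sub_div, div_self (Real.exp_pos 1).ne', one_div]

theorem honestPerturbedGreedy_isCompetitive {B : Type*} [Fintype B] [DecidableEq B]
    (tie : TieBreakingRule B) :
    (honestPerturbedGreedy tie).toRandomizedOnlineAlgorithm.IsCompetitive
      (Real.exp 1 / (Real.exp 1 - 1)) := by
  classical
  intro m v E
  rw [exp_one_div_exp_one_sub_one, inv_mul_eq_div, le_div_iff₀ one_sub_exp_neg_one_pos]
  obtain ⟨μ, hμ, hopt⟩ : ∃ μ, IsMatching E μ ∧ optWelfare v E = socialWelfare v E μ := by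
    have hne : (Finset.univ.filter (IsMatching E)).Nonempty :=
      ⟨fun _ => none, by simp [IsMatching]⟩
    obtain ⟨μ, hμ, h⟩ := Finset.exists_mem_eq_sup _ hne (socialWelfare v E)
    refine ⟨μ, (Finset.mem_filter.1 hμ).2, ?_⟩
    rw [← h, optWelfare]
  rw [hopt]
  exact HPG.socialWelfare_mul_le hμ

/-! ### The lower bound: randomly permuted upper triangular graphs -/

section LowerBound

variable {n : ℕ}

/-- Item `j` is of interest to the buyers `π j, π (j + 1), …, π (n - 1)`. -/
def upperTriangular (π : Equiv.Perm (Fin n)) : Finset (Fin n × Fin n) :=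
  Finset.univ.filter fun p => p.2 ≤ π.symm p.1

theorem mem_upperTriangular {π : Equiv.Perm (Fin n)} {i j : Fin n} :
    (i, j) ∈ upperTriangular π ↔ j ≤ π.symm i := by
  simp [upperTriangular]

theorem le_optWelfare_upperTriangular (π : Equiv.Perm (Fin n)) :
    (n : ℝ≥0) ≤ optWelfare (fun _ => 1) (upperTriangular π) := by
  classical
  have hμ : IsMatching (upperTriangular π) fun j => some (π j) := by
    refine ⟨fun j i h => ?_, fun j j' i h h' => ?_⟩
    · rw [mem_upperTriangular, ← Option.some.inj h, Equiv.symm_apply_apply]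
    · exact π.injective (Option.some.inj (h.trans h'.symm))
  have hsw : socialWelfare (fun _ => 1) (upperTriangular π) (fun j => some (π j)) = n := by
    rw [socialWelfare_eq_sum hμ]
    simp
  rw [← hsw, optWelfare]
  exact Finset.le_sup (f := socialWelfare (fun _ => 1) (upperTriangular π))
    (Finset.mem_filter.2 ⟨Finset.mem_univ _, hμ⟩)

/-! ### Counting the permutations for which a buyer is matched -/

namespace OnlineAlgorithm

variable (A : OnlineAlgorithm (Fin n))

/-- The outcome on the upper triangular graph of `π`, all values being `1`. -/
def triangularOutcome (π : Equiv.Perm (Fin n)) : Fin n → Option (Fin n) :=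
  A.outcome (truthfulBids (fun _ => 1) (upperTriangular π))

variable {A}

theorem le_of_triangularOutcome {π : Equiv.Perm (Fin n)} {j k : Fin n}
    (h : A.triangularOutcome π j = some (π k)) : j ≤ k := by
  have h1 := (isMatching_outcome (A := A) (fun _ => 1) (upperTriangular π)).1 j (π k) h
  rwa [mem_upperTriangular, Equiv.symm_apply_apply] at h1

/-- The algorithm cannot tell apart the buyers that remain interested. -/
theorem triangularOutcome_swap {π : Equiv.Perm (Fin n)} {j k k' : Fin n} (hk : j ≤ k)
    (hk' : j ≤ k') :
    A.triangularOutcome (π * Equiv.swap k k') j = A.triangularOutcome π j := by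
  refine outcome_congr fun l hl => ?_
  funext i
  unfold truthfulBids
  congr 1
  rw [mem_upperTriangular, mem_upperTriangular, ← Equiv.Perm.inv_def, mul_inv_rev,
    Equiv.swap_inv, Equiv.Perm.mul_apply, Equiv.Perm.inv_def]
  by_cases h1 : π.symm i = k
  · rw [h1, Equiv.swap_apply_left]
    exact propext (iff_of_true (hl.trans hk') (hl.trans hk))
  by_cases h2 : π.symm i = k'
  · rw [h2, Equiv.swap_apply_right]
    exact propext (iff_of_true (hl.trans hk) (hl.trans hk'))
  · rw [Equiv.swap_apply_of_ne_of_ne h1 h2]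

variable (A)

/-- The number of permutations for which the `k`-th buyer in the order `π` gets item `j`. -/
def hitCount (j k : Fin n) : ℕ :=
  (Finset.univ.filter fun π : Equiv.Perm (Fin n) => A.triangularOutcome π j = some (π k)).card

/-- Composing `π` with the swap of `k` and `k'` is a bijection that keeps the recipient of item `j`
but moves her from position `k` to `k'`. -/
theorem hitCount_eq {j k k' : Fin n} (hk : j ≤ k) (hk' : j ≤ k') :
    A.hitCount j k = A.hitCount j k' := by
  refine Finset.card_equiv (Equiv.mulRight (Equiv.swap k k')) fun π => ?_
  simp [triangularOutcome_swap hk hk']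

theorem sum_hitCount_le (j : Fin n) : ∑ k, A.hitCount j k ≤ n.factorial := by
  have h : ∑ k, A.hitCount j k = ∑ π : Equiv.Perm (Fin n), (Finset.univ.filter fun k =>
      A.triangularOutcome π j = some (π k)).card := by
    simp only [hitCount, Finset.card_filter]
    exact Finset.sum_comm
  rw [h]
  calc _ ≤ ∑ _π : Equiv.Perm (Fin n), 1 := by
        refine Finset.sum_le_sum fun π _ => Finset.card_le_one.2 fun k hk k' hk' => ?_
        exact π.injective (Option.some.inj
          ((Finset.mem_filter.1 hk).2.symm.trans (Finset.mem_filter.1 hk').2))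
    _ = n.factorial := by simp [Fintype.card_perm]

theorem hitCount_le (j k : Fin n) (hjk : j ≤ k) :
    (A.hitCount j k : ℝ) ≤ n.factorial * (1 / ((n : ℝ) - j)) := by
  -- The `n - j` positions from `j` on have equal counts, and together these are at most `n!`.
  have h1 : (n - (j : ℕ)) * A.hitCount j k ≤ n.factorial := by
    refine le_trans ?_ (A.sum_hitCount_le j)
    calc (n - (j : ℕ)) * A.hitCount j k = ∑ l ∈ Finset.Ici j, A.hitCount j l := by
          rw [Finset.sum_congr rfl fun l hl => A.hitCount_eq (Finset.mem_Ici.1 hl) hjk]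
          simp
      _ ≤ ∑ l, A.hitCount j l :=
          Finset.sum_le_sum_of_subset (Finset.subset_univ _)
  have hpos : (0 : ℝ) < (n : ℝ) - j := sub_pos.2 (by exact_mod_cast j.2)
  rw [mul_one_div, le_div_iff₀ hpos, mul_comm, ← Nat.cast_sub j.2.le]
  exact_mod_cast h1

open Classical in
-- Union bound over the items `j ≤ k`, the only ones that interest the buyer at position `k`.
theorem card_exists_hit_le (k : Fin n) :
    ((Finset.univ.filter fun π : Equiv.Perm (Fin n) =>
      ∃ j, A.triangularOutcome π j = some (π k)).card : ℝ) ≤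
      n.factorial * ∑ j ∈ Finset.range (k + 1), 1 / ((n : ℝ) - j) := by
  have hsub : (Finset.univ.filter fun π : Equiv.Perm (Fin n) =>
      ∃ j, A.triangularOutcome π j = some (π k)) ⊆ (Finset.Iic k).biUnion fun j =>
        Finset.univ.filter fun π : Equiv.Perm (Fin n) =>
          A.triangularOutcome π j = some (π k) := by
    intro π hπ
    obtain ⟨j, hj⟩ := (Finset.mem_filter.1 hπ).2
    exact Finset.mem_biUnion.2 ⟨j, Finset.mem_Iic.2 (le_of_triangularOutcome hj),
      Finset.mem_filter.2 ⟨Finset.mem_univ _, hj⟩⟩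
  have h1 : (Finset.univ.filter fun π : Equiv.Perm (Fin n) =>
      ∃ j, A.triangularOutcome π j = some (π k)).card ≤ ∑ j ∈ Finset.Iic k, A.hitCount j k := by
    refine (Finset.card_le_card hsub).trans (Finset.card_biUnion_le.trans_eq ?_)
    simp [hitCount]
  calc _ ≤ ((∑ j ∈ Finset.Iic k, A.hitCount j k : ℕ) : ℝ) := by exact_mod_cast h1
    _ ≤ ∑ j ∈ Finset.Iic k, n.factorial * (1 / ((n : ℝ) - j)) := by
        rw [Nat.cast_sum]
        exact Finset.sum_le_sum fun j hj => A.hitCount_le j k (by simpa using hj)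
    _ = _ := by
        rw [← Finset.mul_sum]
        congr 1
        refine Finset.sum_bij (fun j _ => (j : ℕ)) ?_ ?_ ?_ ?_
        · intro j hj
          exact Finset.mem_range_succ_iff.2 (Fin.le_def.1 (Finset.mem_Iic.1 hj))
        · exact fun j _ j' _ h => Fin.ext h
        · intro j hj
          have hjk := Finset.mem_range_succ_iff.1 hj
          exact ⟨⟨j, hjk.trans_lt k.2⟩, Finset.mem_Iic.2 hjk, rfl⟩
        · exact fun _ _ => rfl

/-- Exchanging the sums gives terms (K - j)/(n - j) = 1 - (n - K)/(n - j). -/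
theorem sum_sum_one_div {K : ℕ} (hK : K ≤ n) :
    ∑ k ∈ Finset.range K, ∑ j ∈ Finset.range (k + 1), 1 / ((n : ℝ) - j) =
      K - ((n : ℝ) - K) * ∑ j ∈ Finset.range K, 1 / ((n : ℝ) - j) := by
  induction K with
  | zero => simp
  | succ K ih =>
    have hpos : (0 : ℝ) < (n : ℝ) - K := sub_pos.2 (by exact_mod_cast hK)
    rw [Finset.sum_range_succ, ih (Nat.le_of_succ_le hK), Finset.sum_range_succ]
    push_cast
    field_simp
    ring

/-- Each term satisfies 1/(n - j) ≥ log(1 + 1/(n - j)), and these logarithms telescope. -/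
theorem log_le_sum_one_div {K : ℕ} (hK : K ≤ n) :
    Real.log (((n : ℝ) + 1) / ((n : ℝ) - K + 1)) ≤
      ∑ j ∈ Finset.range K, 1 / ((n : ℝ) - j) := by
  induction K with
  | zero => simp [div_self (by positivity : (n : ℝ) + 1 ≠ 0)]
  | succ K ih =>
    have hpos : (0 : ℝ) < (n : ℝ) - K := sub_pos.2 (by exact_mod_cast hK)
    have h1 : ((n : ℝ) + 1) / ((n : ℝ) - (K + 1 : ℕ) + 1) =
        ((n : ℝ) + 1) / ((n : ℝ) - K + 1) * (1 + 1 / ((n : ℝ) - K)) := by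
      have h2 : (n : ℝ) - (K + 1 : ℕ) + 1 = (n : ℝ) - K := by push_cast; ring
      have h3 : (n : ℝ) - K + 1 ≠ 0 := by positivity
      rw [h2]
      field_simp
    rw [Finset.sum_range_succ, h1, Real.log_mul (by positivity) (by positivity)]
    have h4 := Real.log_le_sub_one_of_pos (x := 1 + 1 / ((n : ℝ) - K)) (by positivity)
    linarith [ih (Nat.le_of_succ_le hK)]

theorem sum_socialWelfare_le_of_le {K : ℕ} (hK : K ≤ n) :
    ∑ π : Equiv.Perm (Fin n),
      (socialWelfare (fun _ => 1) (upperTriangular π) (A.triangularOutcome π) : ℝ) ≤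
      n.factorial * (n - ((n : ℝ) - K) * ∑ j ∈ Finset.range K, 1 / ((n : ℝ) - j)) := by
  classical
  set N : Fin n → Finset (Equiv.Perm (Fin n)) := fun k => Finset.univ.filter fun π =>
    ∃ j, A.triangularOutcome π j = some (π k) with hN
  have hsw : ∀ π : Equiv.Perm (Fin n),
      (socialWelfare (fun _ => 1) (upperTriangular π) (A.triangularOutcome π) : ℝ) =
        ∑ k, if π ∈ N k then (1 : ℝ) else 0 := by
    intro π
    have hμ := isMatching_outcome (A := A) (fun _ => 1) (upperTriangular π)
    change IsMatching _ (A.triangularOutcome π) at hμ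
    rw [socialWelfare_eq_sum hμ, sum_elim_eq_sum_ite hμ.2, ← Equiv.sum_comp π, NNReal.coe_sum]
    refine Finset.sum_congr rfl fun k _ => ?_
    by_cases h : ∃ j, A.triangularOutcome π j = some (π k) <;> simp [hN, h]
  have hcard : ∀ k, ((N k).card : ℝ) ≤ n.factorial := by
    intro k
    have := Finset.card_le_univ (N k)
    rw [Fintype.card_perm, Fintype.card_fin] at this
    exact_mod_cast this
  -- The union bound is used for positions before the cut-off `K`, the trivial bound 1 after it.
  set c : ℕ → ℝ := fun k => if k < K then ∑ j ∈ Finset.range (k + 1), 1 / ((n : ℝ) - j) else 1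
    with hc
  have hsum : ∑ k ∈ Finset.range n, c k =
      n - ((n : ℝ) - K) * ∑ j ∈ Finset.range K, 1 / ((n : ℝ) - j) := by
    rw [← Finset.sum_range_add_sum_Ico _ hK,
      Finset.sum_congr rfl fun k hk => if_pos (Finset.mem_range.1 hk), sum_sum_one_div hK,
      Finset.sum_congr rfl fun k hk => if_neg (Finset.mem_Ico.1 hk).1.not_gt]
    simp [Nat.cast_sub hK]
  calc _ = ∑ k, ((N k).card : ℝ) := by
        simp only [hsw]
        rw [Finset.sum_comm]
        simp
    _ ≤ ∑ k : Fin n, n.factorial * c k := by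
        refine Finset.sum_le_sum fun k _ => ?_
        by_cases hk : (k : ℕ) < K
        · simp only [hc, if_pos hk]
          exact A.card_exists_hit_le k
        · simp only [hc, if_neg hk, mul_one]
          exact hcard k
    _ = _ := by rw [← Finset.mul_sum, Fin.sum_univ_eq_sum_range, hsum]

theorem sum_socialWelfare_le :
    ∑ π : Equiv.Perm (Fin n),
      (socialWelfare (fun _ => 1) (upperTriangular π) (A.triangularOutcome π) : ℝ) ≤
      n.factorial * (n * (1 - Real.exp (-1)) + 2) := by
  have hexp : Real.exp (-1) ≤ 1 := Real.exp_le_one_iff.2 (by norm_num)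
  have he := Real.exp_pos (-1)
  suffices h : ∃ r ≤ n, ((n : ℝ) + 1) * Real.exp (-1) - 2 ≤
      r * ∑ j ∈ Finset.range (n - r), 1 / ((n : ℝ) - j) by
    obtain ⟨r, hr, h⟩ := h
    refine (A.sum_socialWelfare_le_of_le (Nat.sub_le n r)).trans ?_
    rw [Nat.cast_sub hr, sub_sub_cancel]
    gcongr
    linarith
  -- Here r = n - K. If (n + 1)/e < 1, the left side is negative and r = 0 will do. Otherwise take r
  -- + 1 = ⌊(n + 1)/e⌋: then log((n + 1)/(r + 1)) ≥ 1, so the harmonic sum is at least 1, and r is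
  -- less than 2 below (n + 1)/e.
  rcases lt_or_ge (((n : ℝ) + 1) * Real.exp (-1)) 1 with hlt | hge
  · exact ⟨0, Nat.zero_le n, by simp; linarith⟩
  · have hfl := Nat.floor_le (zero_le_one.trans hge)
    have hfl' := Nat.lt_floor_add_one (((n : ℝ) + 1) * Real.exp (-1))
    obtain ⟨r, hr⟩ := Nat.exists_eq_succ_of_ne_zero (Nat.floor_pos.2 hge).ne'
    rw [hr] at hfl hfl'
    push_cast at hfl hfl'
    have hrn : r ≤ n := by
      have : ((n : ℝ) + 1) * Real.exp (-1) ≤ n + 1 := mul_le_of_le_one_right (by positivity) hexp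
      have : (r : ℝ) ≤ n := by linarith
      exact_mod_cast this
    refine ⟨r, hrn, ?_⟩
    have hlog := log_le_sum_one_div (Nat.sub_le n r)
    rw [Nat.cast_sub hrn, sub_sub_cancel] at hlog
    have h1 : 1 ≤ Real.log (((n : ℝ) + 1) / (r + 1)) := by
      rw [Real.le_log_iff_exp_le (by positivity), le_div_iff₀ (by positivity)]
      calc Real.exp 1 * (r + 1) ≤ Real.exp 1 * ((n + 1) * Real.exp (-1)) := by gcongr
        _ = (n + 1) * (Real.exp 1 * Real.exp (-1)) := by ring
        _ = n + 1 := by rw [← Real.exp_add]; simp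
    have h2 : (r : ℝ) * 1 ≤ r * ∑ j ∈ Finset.range (n - r), 1 / ((n : ℝ) - j) :=
      mul_le_mul_of_nonneg_left (h1.trans hlog) (Nat.cast_nonneg r)
    linarith

end OnlineAlgorithm

theorem RandomizedOnlineAlgorithm.exists_expectedWelfare_le
    (A : RandomizedOnlineAlgorithm (Fin n)) :
    ∃ π : Equiv.Perm (Fin n), A.expectedWelfare (fun _ => 1) (upperTriangular π) ≤
      n * (1 - Real.exp (-1)) + 2 := by
  have hsum : ∑ π : Equiv.Perm (Fin n), A.expectedWelfare (fun _ => 1) (upperTriangular π) ≤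
      ∑ _π : Equiv.Perm (Fin n), (n * (1 - Real.exp (-1)) + 2) := by
    unfold expectedWelfare
    rw [← integral_finsetSum _ fun π _ => A.integrable_socialWelfare _ _ _]
    calc _ ≤ ∫ _ω, n.factorial * (n * (1 - Real.exp (-1)) + 2) ∂A.P :=
          integral_mono (integrable_finsetSum _ fun π _ => A.integrable_socialWelfare _ _ _)
            (integrable_const _) fun ω => (A.realize ω).sum_socialWelfare_le
      _ = _ := by simp [Fintype.card_perm, mul_add]
  obtain ⟨π, -, h⟩ := Finset.exists_le_of_sum_le Finset.univ_nonempty hsum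
  exact ⟨π, h⟩

theorem exists_lt_optWelfare {α : ℝ} (hα : α < Real.exp 1 / (Real.exp 1 - 1)) :
    ∃ n : ℕ, ∀ A : RandomizedOnlineAlgorithm.{0, w} (Fin n), ∃ E : Finset (Fin n × Fin n),
      α * A.expectedWelfare (fun _ => 1) E < (optWelfare (fun _ => 1) E : ℝ) := by
  have hpos := one_sub_exp_neg_one_pos
  rw [exp_one_div_exp_one_sub_one, inv_eq_one_div] at hα
  have hgap : 0 < 1 - max α 0 * (1 - Real.exp (-1)) :=
    sub_pos.2 ((lt_div_iff₀ hpos).1 (max_lt hα (by positivity)))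
  -- This `n` makes the linear gap outweigh the additive error 2. The maximum with 0 covers negative
  -- `α`, for which multiplication would reverse the bound on the welfare.
  obtain ⟨n, hn⟩ := exists_nat_gt (2 * max α 0 / (1 - max α 0 * (1 - Real.exp (-1))))
  rw [div_lt_iff₀ hgap] at hn
  refine ⟨n, fun A => ?_⟩
  obtain ⟨π, hπ⟩ := A.exists_expectedWelfare_le
  refine ⟨upperTriangular π, ?_⟩
  have h0 : 0 ≤ A.expectedWelfare (fun _ => 1) (upperTriangular π) :=
    integral_nonneg fun _ => NNReal.coe_nonneg _
  calc α * A.expectedWelfare (fun _ => 1) (upperTriangular π)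
      ≤ max α 0 * A.expectedWelfare (fun _ => 1) (upperTriangular π) := by
        gcongr
        exact le_max_left _ _
    _ ≤ max α 0 * (n * (1 - Real.exp (-1)) + 2) := by
        gcongr
    _ < n := by linarith
    _ ≤ _ := by exact_mod_cast le_optWelfare_upperTriangular π

end LowerBound

end OnlineMatching

theorem mainTheorem1 :
    -- upper bound: the mechanism, for every finite set of buyers and every tie-breaking rule
    (∀ (B : Type u) [Fintype B] [DecidableEq B] (tie : OnlineMatching.TieBreakingRule B),
      (OnlineMatching.honestPerturbedGreedy tie).IsTruthfulForMyopic ∧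
      (OnlineMatching.honestPerturbedGreedy tie).IsIndividuallyRational ∧
      (OnlineMatching.honestPerturbedGreedy tie).ChargesCriticalPrices ∧
      (OnlineMatching.honestPerturbedGreedy tie).toRandomizedOnlineAlgorithm.IsCompetitive
        (Real.exp 1 / (Real.exp 1 - 1))) ∧
    -- lower bound: no randomized online algorithm does better, not even one that is designed for
    -- the given numbers of buyers and items and knows the values of all buyers in advance
    (∀ α : ℝ, α < Real.exp 1 / (Real.exp 1 - 1) →
      ∃ n m : ℕ, ∀ A : (Fin n → NNReal) →
          OnlineMatching.RandomizedOnlineAlgorithm.{0, w} (Fin n),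
        ∃ (v : Fin n → NNReal) (E : Finset (Fin n × Fin m)),
          α * (A v).expectedWelfare v E < (OnlineMatching.optWelfare v E : ℝ)) := by
  refine ⟨fun B _ _ tie => ⟨OnlineMatching.honestPerturbedGreedy_isTruthfulForMyopic tie,
    OnlineMatching.honestPerturbedGreedy_isIndividuallyRational tie,
    OnlineMatching.honestPerturbedGreedy_chargesCriticalPrices tie,
    OnlineMatching.honestPerturbedGreedy_isCompetitive tie⟩, fun α hα => ?_⟩
  obtain ⟨n, hn⟩ := OnlineMatching.exists_lt_optWelfare hα
  refine ⟨n, n, fun A => ?_⟩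
  -- The hard instances all have unit values, so advance knowledge of the values merely selects one
  -- fixed algorithm.
  obtain ⟨E, hE⟩ := hn (A fun _ => 1)
  exact ⟨fun _ => 1, E, hE⟩
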